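/- **Setting.** Let $\gamma>1$, $\beta>0$, $L>0$, $\sigma>0$, $\alpha\in(0,1)$. Let $(\bar\rho_\pm,\bar u_\pm,0,\bar P_\pm)(x_2)$, $x_2\in[0,1]$, be a background normal transonic shock: positive $C^3([0,1])$ functions such that each of the two states solves the steady rotating Euler system $$\begin{cases}\partial_{1}(\rho u_1)+\partial_{2}(\rho u_2)=0,\\ \partial_{1}(\rho u_1^2+P)+\partial_{2}(\rho u_1u_2)-\beta\rho u_2=0,\\ \partial_{1}(\rho u_1u_2)+\partial_{2}(\rho u_2^2+P)+\beta\rho u_1=0,\\ \partial_{1}(\rho u_1E+u_1P)+\partial_{2}(\rho u_2E+u_2P)=0,\end{cases}\qquad E=\tfrac12|\mathbf u|^2+\tfrac{P}{(\gamma-1)\rho},$$ in $(0,L)\times(0,1)$, with $\bar M_-^2>1>\bar M_+^2$ on $[0,1]$, where $\bar M_\pm^2=\bar u_\pm^2\bar\rho_\pm/(\gamma\bar P_\pm)$, and with the Rankine–Hugoniot conditions $[\bar\rho\bar u]=[\bar\rho\bar u^2+\bar P]=[\bar B]=0$ on $[0,1]$, where $[f]=f_+-f_-$ and $\bar B_\pm=\frac12\bar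 u_\pm^2+\frac{\gamma\bar P_\pm}{(\gamma-1)\bar\rho_\pm}$; put $\bar S_\pm=\ln(\bar P_\pm/\bar\rho_\pm^\gamma)$. Let $\bar m=\int_0^1\bar\rho_-\bar u_-\,ds$, $\mathcal N=(0,L)\times(0,\bar m)$, and let $\bar X_2:[0,\bar m]\to[0,1]$ be the inverse of $x\mapsto\int_0^{x}\bar\rho_-\bar u_-\,ds$. A hat denotes a background quantity composed with $\bar X_2$: $\hat\rho_\pm=\bar\rho_\pm\circ\bar X_2$, etc. Put $\hat c_\pm^2=\gamma\hat P_\pm/\hat\rho_\pm$ and $\hat M_\pm^2=\hat u_\pm^2/\hat c_\pm^2$. Let $g\in C^{3,\alpha}([0,L])$ with $g^{(i)}(0)=0$ for $i=0,\dots,3$; let $u_{1,en},u_{2,en},S_{en},B_{en}\in C^{2,\alpha}([0,1])$ with $u_{2,en}(0)=u_{2,en}(1)=0$; and let $P_{ex}\in C([0,1])$. Assume that the entrance state $(\bar u_-+\sigma u_{1,en},\ \sigma u_{2,en},\ \bar S_-+\sigma S_{en},\ \bar B_-+\sigma B_{en})$ satisfies, on $[0,1]$, $\bar u_-+\sigma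 u_{1,en}>0$ and $h>0$, where $h=\bar B_-+\sigma B_{en}-\frac12\big((\bar u_-+\sigma u_{1,en})^2+(\sigma u_{2,en})^2\big)$. Its mass flux is $$q=\Big(\tfrac{\gamma-1}{\gamma e^{\bar S_-+\sigma S_{en}}}\,h\Big)^{\frac1{\gamma-1}}(\bar u_-+\sigma u_{1,en}).$$ Put $m=\int_0^1q\,ds$, let $X_{en}:[0,\bar m]\to[0,1]$ be the inverse of $x\mapsto\frac{\bar m}{m}\int_0^xq\,ds$, and let $\tilde{\boldsymbol V}_{en}=(\tilde u_{1,en},\tilde u_{2,en},\tilde S_{en},\tilde B_{en})=(u_{1,en},u_{2,en},S_{en},B_{en})\circ X_{en}$. Define on $[0,\bar m]$ $$b_{2,\pm}(y_2)=e^{-\int_0^{y_2}\hat u_\pm'/\hat u_\pm\,ds},\quad b_{1,\pm}=\frac{1-\hat M_\pm^2}{\hat\rho_\pm\hat u_\pm}b_{2,\pm},\quad b_{4,-}(y_2)=e^{\int_0^{y_2}\left(\frac{\hat u_-'}{\hat u_-}-\frac{\beta}{\hat\rho_-\hat c_-^2}-\frac{\hat S_-'}{\gamma}\right)ds},\quad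 b_{3,-}=\frac{b_{4,-}}{\hat\rho_-\hat u_-},$$ $$\mathfrak a_1=\frac{\hat M_+^2}{\hat M_-^2}\,\frac{\hat M_-^2-1}{\hat M_+^2-1},\qquad \mathfrak a_3=-\frac{\hat M_-^2-1}{\hat\rho_+\hat u_+\hat u_-}\,(\hat P_+-\hat P_-).$$ Let $\dot{\boldsymbol V}_-=(\dot u_{1,-},\dot u_{2,-},\dot S_-,\dot B_-)\in C^{2,\alpha}(\overline{\mathcal N})$ solve the linearized supersonic problem $$\begin{cases}\partial_{y_1}(b_{1,-}\dot u_{1,-})+\partial_{y_2}(b_{2,-}\dot u_{2,-})=0,\\ \partial_{y_1}(b_{3,-}\dot u_{2,-})-\partial_{y_2}(b_{4,-}\dot u_{1,-})=b_{3,-}\Big(\frac{e^{\hat S_-}\hat\rho_-^\gamma}{\gamma-1}\partial_{y_2}\dot S_--\frac{\beta}{\gamma-1}\dot S_--\hat\rho_-\partial_{y_2}\dot B_-+\big(\frac{\beta}{\hat c_-^2}+\frac{\hat\rho_-\hat S_-'}{\gamma}\big)\dot B_-\Big),\\ \partial_{y_1}\dot S_-=\partial_{y_1}\dot B_-=0\end{cases}$$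 in $\mathcal N$, with $\dot{\boldsymbol V}_-(0,y_2)=\sigma\tilde{\boldsymbol V}_{en}(y_2)$, $\dot u_{2,-}(y_1,\bar m)=\sigma\hat u_-(\bar m)g'(y_1)$ and $\dot u_{2,-}(y_1,0)=0$. Let $\mathcal C_->0$ be a constant with $\|\dot{\boldsymbol V}_-\|_{2,\alpha;\overline{\mathcal N}}\le\mathcal C_-\sigma$ (the norm of a vector is the sum of the standard Hölder norms of its components). Put $$J_1(\bar\psi)=\frac1\sigma\int_0^{\bar m}(\mathfrak a_3-\mathfrak a_1)(y_2)\,b_{1,+}(y_2)\,\dot u_{1,-}(\bar\psi,y_2)\,dy_2+(b_{2,+}\hat u_+)(\bar m)\,\big(g(L)-g(\bar\psi)\big),$$ $$J_2=\int_0^{\bar m}b_{1,+}\Big(\frac{P_{ex}\circ\bar X_2}{\hat\rho_+\hat u_+}+\frac{\hat P_+\tilde S_{en}}{(\gamma-1)\hat\rho_+\hat u_+}-\frac{\tilde B_{en}}{\hat u_+}\Big)dy_2,$$ $$I=\int_0^{\bar m}\Big(\frac{b_{1,+}(\mathfrak a_3-\mathfrak a_1)}{b_{1,-}}\Big)'\,b_{2,-}\,\tilde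 u_{2,en}\,dy_2,$$ $$\mathfrak C=\mathcal C_-\int_0^{\bar m}\big|(\mathfrak a_3-\mathfrak a_1)b_{1,+}\big|\,dy_2+(b_{2,+}\hat u_+)(\bar m)\,\|g''\|_{L^\infty[0,L]}.$$ **Lemma.** We have $\mathfrak C>0$ and $$J_1(0)=\int_0^{\bar m}(\mathfrak a_3-\mathfrak a_1)\,b_{1,+}\,\tilde u_{1,en}\,dy_2+(b_{2,+}\hat u_+)(\bar m)\,g(L).$$ (i) If $I>0$ and $0<L_+<\min\{I/\mathfrak C,\,L\}$, then $J_*(L_+):=L_+\big(I-\frac{L_+}{2}\mathfrak C\big)>0$; and if $J_1(0)<J_2<J_1(0)+J_*(L_+)$, then there is a unique $\bar\psi\in(0,L_+)$ with $J_1(\bar\psi)=J_2$. (ii) If $I<0$ and $0<L_-<\min\{-I/\mathfrak C,\,L\}$, then $J_\star(L_-):=L_-\big(I+\frac{L_-}{2}\mathfrak C\big)<0$; and if $J_1(0)+J_\star(L_-)<J_2<J_1(0)$, then there is a unique $\bar\psi\in(0,L_-)$ with $J_1(\bar\psi)=J_2$. -/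

import Mathlib

open Set
open scoped ENNReal

noncomputable section

namespace RotShock

/-! Partial derivatives and Hölder norms in the plane. -/

/-- The partial derivative with respect to the first variable. -/
def pd₁ (f : ℝ × ℝ → ℝ) (y : ℝ × ℝ) : ℝ := deriv (fun t => f (t, y.2)) y.1

/-- The partial derivative with respect to the second variable. -/
def pd₂ (f : ℝ × ℝ → ℝ) (y : ℝ × ℝ) : ℝ := deriv (fun t => f (y.1, t)) y.2

/-- The derivative `∂₁^a ∂₂^b f` for the multi-index `ν = (a, b)`. -/
def pdMulti (ν : ℕ × ℕ) (f : ℝ × ℝ → ℝ) : ℝ × ℝ → ℝ := pd₁^[ν.1] (pd₂^[ν.2] f)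

/-- The Euclidean distance in the plane (the distance of the type `ℝ × ℝ` is the maximum one). -/
def euclDist (y z : ℝ × ℝ) : ℝ := √((y.1 - z.1) ^ 2 + (y.2 - z.2) ^ 2)

/-- The norm `‖f‖_{k;N}`: the sum over `|ν| ≤ k` of the suprema of `|D^ν f|` over the open set `N`. -/
def supNorm (k : ℕ) (N : Set (ℝ × ℝ)) (f : ℝ × ℝ → ℝ) : ℝ≥0∞ :=
  ∑ j ∈ Finset.range (k + 1), ∑ ν ∈ Finset.HasAntidiagonal.antidiagonal j,
    ⨆ y ∈ N, ENNReal.ofReal |pdMulti ν f y|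

/-- The Hölder seminorm `[f]_{k,α;N}`. -/
def holderSeminorm (k : ℕ) (α : ℝ) (N : Set (ℝ × ℝ)) (f : ℝ × ℝ → ℝ) : ℝ≥0∞ :=
  ∑ ν ∈ Finset.HasAntidiagonal.antidiagonal k, ⨆ y ∈ N, ⨆ z ∈ N, ⨆ _ : y ≠ z,
    ENNReal.ofReal (|pdMulti ν f y - pdMulti ν f z| / euclDist y z ^ α)

/-- The Hölder norm `‖f‖_{k,α;N}`, with value `∞` allowed. -/
def holderNorm (k : ℕ) (α : ℝ) (N : Set (ℝ × ℝ)) (f : ℝ × ℝ → ℝ) : ℝ≥0∞ :=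
  supNorm k N f + holderSeminorm k α N f

/-- The class `C^{k,α}([a,b])` of functions of one variable. -/
def InHolder (k : ℕ) (α a b : ℝ) (f : ℝ → ℝ) : Prop :=
  ContDiffOn ℝ k f (Icc a b) ∧
    ∃ C : ℝ, ∀ x ∈ Icc a b, ∀ y ∈ Icc a b,
      |iteratedDerivWithin k f (Icc a b) x - iteratedDerivWithin k f (Icc a b) y| ≤ C * |x - y| ^ α

/-! The steady rotating Euler system and states that depend on one variable. -/

/-- The steady rotating Euler system for an ideal polytropic gas with adiabatic exponent `γ` and
Coriolis parameter `β`, for density `ρ`, velocity `(u₁, u₂)` and pressure `P` in the open set `D`. -/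
structure SolvesRotEuler (γ β : ℝ) (D : Set (ℝ × ℝ)) (ρ u₁ u₂ P : ℝ × ℝ → ℝ) : Prop where
  mass : ∀ x ∈ D, pd₁ (fun z => ρ z * u₁ z) x + pd₂ (fun z => ρ z * u₂ z) x = 0
  momentum₁ : ∀ x ∈ D,
    pd₁ (fun z => ρ z * u₁ z ^ 2 + P z) x + pd₂ (fun z => ρ z * u₁ z * u₂ z) x
      - β * ρ x * u₂ x = 0
  momentum₂ : ∀ x ∈ D,
    pd₁ (fun z => ρ z * u₁ z * u₂ z) x + pd₂ (fun z => ρ z * u₂ z ^ 2 + P z) x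
      + β * ρ x * u₁ x = 0
  energy : ∀ x ∈ D,
    pd₁ (fun z => ρ z * u₁ z * ((u₁ z ^ 2 + u₂ z ^ 2) / 2 + P z / ((γ - 1) * ρ z))
        + u₁ z * P z) x
      + pd₂ (fun z => ρ z * u₂ z * ((u₁ z ^ 2 + u₂ z ^ 2) / 2 + P z / ((γ - 1) * ρ z))
        + u₂ z * P z) x = 0

/-- A horizontal flow `(ρ, u, 0, P)` that depends on one variable. -/
structure Profile where
  /-- density -/
  ρ : ℝ → ℝ
  /-- horizontal velocity -/
  u : ℝ → ℝ
  /-- pressure -/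
  P : ℝ → ℝ

namespace Profile

/-- The square of the sound speed, `c² = ∂P/∂ρ = γ e^S ρ^(γ-1) = γ P / ρ`. -/
def cSq (γ : ℝ) (p : Profile) (s : ℝ) : ℝ := γ * p.P s / p.ρ s

/-- The square of the Mach number. -/
def machSq (γ : ℝ) (p : Profile) (s : ℝ) : ℝ := p.u s ^ 2 / p.cSq γ s

/-- The entropy `S = ln (P / ρ^γ)`. -/
def entropy (γ : ℝ) (p : Profile) (s : ℝ) : ℝ := Real.log (p.P s / p.ρ s ^ γ)

/-- The Bernoulli function. -/
def bernoulli (γ : ℝ) (p : Profile) (s : ℝ) : ℝ :=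
  p.u s ^ 2 / 2 + γ * p.P s / ((γ - 1) * p.ρ s)

/-- The profile in a new variable. -/
def comp (p : Profile) (X : ℝ → ℝ) : Profile := ⟨p.ρ ∘ X, p.u ∘ X, p.P ∘ X⟩

/-- The profile `(ρ, u, 0, P)(x₂)` is a positive `C³` solution of the rotating Euler system in the
flat nozzle `(0,L) × (0,1)`. -/
structure IsFlow (γ β L : ℝ) (p : Profile) : Prop where
  smooth_ρ : ContDiffOn ℝ 3 p.ρ (Icc 0 1)
  smooth_u : ContDiffOn ℝ 3 p.u (Icc 0 1)
  smooth_P : ContDiffOn ℝ 3 p.P (Icc 0 1)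
  pos_ρ : ∀ s ∈ Icc (0 : ℝ) 1, 0 < p.ρ s
  pos_u : ∀ s ∈ Icc (0 : ℝ) 1, 0 < p.u s
  pos_P : ∀ s ∈ Icc (0 : ℝ) 1, 0 < p.P s
  euler : SolvesRotEuler γ β (Ioo 0 L ×ˢ Ioo 0 1)
    (fun x => p.ρ x.2) (fun x => p.u x.2) (fun _ => 0) (fun x => p.P x.2)

end Profile

/-- `(pm, pp)` is a normal transonic background shock: a supersonic upstream flow `pm` and a
subsonic downstream flow `pp` related by the Rankine-Hugoniot conditions across a vertical front
(whose position is arbitrary, both flows being independent of `x₁`). -/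
structure IsBackgroundShock (γ β L : ℝ) (pm pp : Profile) : Prop where
  flow_minus : pm.IsFlow γ β L
  flow_plus : pp.IsFlow γ β L
  supersonic : ∀ s ∈ Icc (0 : ℝ) 1, 1 < pm.machSq γ s
  subsonic : ∀ s ∈ Icc (0 : ℝ) 1, pp.machSq γ s < 1
  jump_mass : ∀ s ∈ Icc (0 : ℝ) 1, pp.ρ s * pp.u s = pm.ρ s * pm.u s
  jump_momentum : ∀ s ∈ Icc (0 : ℝ) 1,
    pp.ρ s * pp.u s ^ 2 + pp.P s = pm.ρ s * pm.u s ^ 2 + pm.P s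
  jump_bernoulli : ∀ s ∈ Icc (0 : ℝ) 1, pp.bernoulli γ s = pm.bernoulli γ s

/-! The data of the perturbed nozzle problem. -/

/-- The parameters and the data: adiabatic exponent `γ`, Coriolis parameter `β`, length `L`, size
`σ` of the perturbation, background states, wall perturbation `g`, perturbations
`(u₁, u₂, S, B)_en (x₂)` of the entrance state and `P_ex (x₂)` of the exit pressure. -/
structure Data where
  γ : ℝ
  β : ℝ
  L : ℝ
  σ : ℝ
  pm : Profile
  pp : Profile
  g : ℝ → ℝ
  u₁en : ℝ → ℝ
  u₂en : ℝ → ℝ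
  Sen : ℝ → ℝ
  Ben : ℝ → ℝ
  Pex : ℝ → ℝ

namespace Data

variable (d : Data)

/-- The total background mass flux `m̄ = ∫₀¹ ρ̄₋ ū₋`. -/
def mbar : ℝ := ∫ s in (0 : ℝ)..1, d.pm.ρ s * d.pm.u s

/-- The Lagrangian coordinate `x₂ ↦ ∫₀^{x₂} ρ̄₋ ū₋` of the background flow. -/
def Ybar (x : ℝ) : ℝ := ∫ s in (0 : ℝ)..x, d.pm.ρ s * d.pm.u s

/-- The Eulerian coordinate `X̄₂ (y₂) ∈ [0,1]` of the background flow, for `y₂ ∈ [0, m̄]`: the inverse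
of `Ybar`, that is, the solution of `X̄₂' = 1 / (ρ̄₋ ū₋)(X̄₂)`, `X̄₂ (0) = 0`. -/
def Xbar : ℝ → ℝ := Function.invFunOn d.Ybar (Icc 0 1)

/-- The upstream background state in the Lagrangian coordinate. -/
def hm : Profile := d.pm.comp d.Xbar

/-- The downstream background state in the Lagrangian coordinate. -/
def hp : Profile := d.pp.comp d.Xbar

/-- `B - |u|²/2` for the total entrance state, the background plus `σ` times the perturbation. -/
def enthalpyEn (s : ℝ) : ℝ :=
  (d.pm.bernoulli d.γ s + d.σ * d.Ben s)
    - ((d.pm.u s + d.σ * d.u₁en s) ^ 2 + (d.σ * d.u₂en s) ^ 2) / 2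

/-- The density of the total entrance state, from the equation of state. -/
def ρTotEn (s : ℝ) : ℝ :=
  ((d.γ - 1) / (d.γ * Real.exp (d.pm.entropy d.γ s + d.σ * d.Sen s)) * d.enthalpyEn s)
    ^ (1 / (d.γ - 1))

/-- The horizontal mass flux `(ρ₋ u₁₋)(0, x₂)` at the entrance. -/
def fluxEn (s : ℝ) : ℝ := d.ρTotEn s * (d.pm.u s + d.σ * d.u₁en s)

/-- The total mass flux `m = ∫₀¹ (ρ₋ u₁₋)(0, s) ds`. -/
def m : ℝ := ∫ s in (0 : ℝ)..1, d.fluxEn s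

/-- The Lagrangian coordinate at the entrance, normalized to take values in `[0, m̄]`. -/
def Yen (x : ℝ) : ℝ := d.mbar / d.m * ∫ s in (0 : ℝ)..x, d.fluxEn s

/-- The Eulerian coordinate at the entrance, the inverse of `Yen`. -/
def Xen : ℝ → ℝ := Function.invFunOn d.Yen (Icc 0 1)

/-- The entrance data `(ũ₁, ũ₂, S̃, B̃)_en` in the Lagrangian coordinate. -/
def Ven : Fin 4 → ℝ → ℝ :=
  ![d.u₁en ∘ d.Xen, d.u₂en ∘ d.Xen, d.Sen ∘ d.Xen, d.Ben ∘ d.Xen]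

/-- The standing assumptions on parameters and data. -/
structure Admissible (α : ℝ) : Prop where
  one_lt_γ : 1 < d.γ
  β_pos : 0 < d.β
  L_pos : 0 < d.L
  σ_pos : 0 < d.σ
  background : IsBackgroundShock d.γ d.β d.L d.pm d.pp
  g_holder : InHolder 3 α 0 d.L d.g
  g_flat : ∀ i ≤ 3, iteratedDerivWithin i d.g (Icc 0 d.L) 0 = 0
  u₁en_holder : InHolder 2 α 0 1 d.u₁en
  u₂en_holder : InHolder 2 α 0 1 d.u₂en
  Sen_holder : InHolder 2 α 0 1 d.Sen
  Ben_holder : InHolder 2 α 0 1 d.Ben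
  u₂en_zero : d.u₂en 0 = 0
  u₂en_one : d.u₂en 1 = 0
  Pex_cont : ContinuousOn d.Pex (Icc 0 1)
  /-- the total entrance state has positive density and moves to the right (`σ` is small) -/
  enthalpyEn_pos : ∀ s ∈ Icc (0 : ℝ) 1, 0 < d.enthalpyEn s
  velocityEn_pos : ∀ s ∈ Icc (0 : ℝ) 1, 0 < d.pm.u s + d.σ * d.u₁en s

/-! Coefficients of the linearized problem; `q` is one of the states `hm`, `hp`. -/

/-- The coefficient `b₂`. -/
def b₂ (q : Profile) (y : ℝ) : ℝ := Real.exp (∫ s in (0 : ℝ)..y, -(deriv q.u s / q.u s))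

/-- The coefficient `b₁`. -/
def b₁ (q : Profile) (y : ℝ) : ℝ := (1 - q.machSq d.γ y) / (q.ρ y * q.u y) * b₂ q y

/-- The coefficient `b₄`. -/
def b₄ (q : Profile) (y : ℝ) : ℝ :=
  Real.exp (∫ s in (0 : ℝ)..y,
    (deriv q.u s / q.u s - d.β / (q.ρ s * q.cSq d.γ s) - deriv (q.entropy d.γ) s / d.γ))

/-- The coefficient `b₃`. -/
def b₃ (q : Profile) (y : ℝ) : ℝ := 1 / (q.ρ y * q.u y) * d.b₄ q y

/-- The jump `[P̂] = P̂₊ - P̂₋`. -/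
def jumpP (y : ℝ) : ℝ := d.hp.P y - d.hm.P y

/-- The coefficient `𝔞₁`. -/
def a₁ (y : ℝ) : ℝ :=
  d.hp.machSq d.γ y / d.hm.machSq d.γ y * ((d.hm.machSq d.γ y - 1) / (d.hp.machSq d.γ y - 1))

/-- The coefficient `𝔞₃`. -/
def a₃ (y : ℝ) : ℝ :=
  -((d.hm.machSq d.γ y - 1) / (d.hp.ρ y * d.hp.u y * d.hm.u y)) * d.jumpP y

/-- The open rectangle `𝒩 = (0,L) × (0,m̄)`. -/
def rect : Set (ℝ × ℝ) := Ioo 0 d.L ×ˢ Ioo 0 d.mbar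

/-- `V = (u̇₁, u̇₂, Ṡ, Ḃ)₋` is a solution of class `C^{2,α}` up to the boundary of the linearized
supersonic problem in the rectangle. -/
structure IsLinSupersonic (α : ℝ) (V : Fin 4 → ℝ × ℝ → ℝ) : Prop where
  cont : ∀ i, ContinuousOn (V i) (Icc 0 d.L ×ˢ Icc 0 d.mbar)
  smooth : ∀ i, ContDiffOn ℝ 2 (V i) d.rect
  holder : ∀ i, holderNorm 2 α d.rect (V i) ≠ ∞
  eq_div : ∀ y ∈ d.rect,
    pd₁ (fun z => d.b₁ d.hm z.2 * V 0 z) y + pd₂ (fun z => b₂ d.hm z.2 * V 1 z) y = 0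
  eq_curl : ∀ y ∈ d.rect,
    pd₁ (fun z => d.b₃ d.hm z.2 * V 1 z) y - pd₂ (fun z => d.b₄ d.hm z.2 * V 0 z) y
      = d.b₃ d.hm y.2 *
        (Real.exp (d.hm.entropy d.γ y.2) * d.hm.ρ y.2 ^ d.γ / (d.γ - 1) * pd₂ (V 2) y
          - d.β / (d.γ - 1) * V 2 y
          - d.hm.ρ y.2 * pd₂ (V 3) y
          + (d.β / d.hm.cSq d.γ y.2
              + d.hm.ρ y.2 * deriv (d.hm.entropy d.γ) y.2 / d.γ) * V 3 y)
  eq_entropy : ∀ y ∈ d.rect, pd₁ (V 2) y = 0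
  eq_bernoulli : ∀ y ∈ d.rect, pd₁ (V 3) y = 0
  entrance : ∀ i, ∀ y₂ ∈ Icc 0 d.mbar, V i (0, y₂) = d.σ * d.Ven i y₂
  upper_wall : ∀ y₁ ∈ Icc 0 d.L,
    V 1 (y₁, d.mbar) = d.σ * d.hm.u d.mbar * derivWithin d.g (Icc 0 d.L) y₁
  lower_wall : ∀ y₁ ∈ Icc 0 d.L, V 1 (y₁, 0) = 0

/-! The quantities of the solvability condition. -/

/-- The function `J₁ (ψ)`, for the linearized supersonic solution `V`. -/
def J₁ (V : Fin 4 → ℝ × ℝ → ℝ) (ψ : ℝ) : ℝ :=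
  1 / d.σ * (∫ y in (0 : ℝ)..d.mbar, (d.a₃ y - d.a₁ y) * d.b₁ d.hp y * V 0 (ψ, y))
    + b₂ d.hp d.mbar * d.hp.u d.mbar * (d.g d.L - d.g ψ)

/-- The number `J₂`. -/
def J₂ : ℝ :=
  ∫ y in (0 : ℝ)..d.mbar, d.b₁ d.hp y *
    (d.Pex (d.Xbar y) / (d.hp.ρ y * d.hp.u y)
      + d.hp.P y * d.Ven 2 y / ((d.γ - 1) * (d.hp.ρ y * d.hp.u y))
      - d.Ven 3 y / d.hp.u y)

/-- The integral `∫₀^m̄ (b₁₊ (𝔞₃ - 𝔞₁) / b₁₋)' b₂₋ ũ₂_en`, whose sign distinguishes the cases. -/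
def I : ℝ :=
  ∫ y in (0 : ℝ)..d.mbar,
    deriv (fun s => d.b₁ d.hp s * (d.a₃ s - d.a₁ s) / d.b₁ d.hm s) y * (b₂ d.hm y * d.Ven 1 y)

/-- The constant `ℭ` built from a constant `Cm` in the estimate of the supersonic solution. -/
def C (Cm : ℝ) : ℝ :=
  Cm * (∫ y in (0 : ℝ)..d.mbar, |(d.a₃ y - d.a₁ y) * d.b₁ d.hp y|)
    + b₂ d.hp d.mbar * d.hp.u d.mbar
      * sSup ((fun y => |iteratedDerivWithin 2 d.g (Icc 0 d.L) y|) '' Icc 0 d.L)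

end Data

end RotShock

end

noncomputable section

namespace RotShock

open MeasureTheory Filter Topology

/-! Calculus on intervals. -/

/-! Everything follows from the estimate |J₁'(ψ) − I| ≤ ℭψ on (0,L) (`abs_J₁Deriv_sub_I_le`). If I >
0 and ψ < L₊ < I/ℭ, it makes J₁ strictly increasing, and integrating J₁' ≥ I − ℭψ gives J₁(L₊) ≥
J₁(0) + J_*(L₊); the intermediate value theorem concludes (`existsUnique_eq_of_le_deriv`). The case
I < 0 is the same argument for −J₁.

The estimate has two sources. The derivative J₁' is Lipschitz with constant ℭ, because ∂₁²u̇₁ is at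
most 𝒞₋σ and g' has Lipschitz constant sup|g''| (`abs_J₁Deriv_sub_le`). Its limit at 0 is I: the
divergence equation turns ∂₁u̇₁ into −∂₂(b₂₋u̇₂)/b₁₋, and an integration by parts in y₂
(`J₁Deriv_eq_byParts`) leaves an expression in the values of u̇₂ alone. This is continuous up to ψ =
0, where the entrance data are known and g'(0) = 0.

Positivity of ℭ is the place where rotation enters. If 𝔞₁ = 𝔞₃ identically, the Rankine–Hugoniot
conditions force P₊ = (1+γ)P₋ (`pressure_eq_of_coefficients_eq`). But P' = −βρu on both sides with
the same mass flux, so P₊' = P₋' ≠ 0, a contradiction (`IsBackgroundShock.exists_coefficients_ne`).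
-/

lemma hasDerivAt_of_contDiffOn_Icc {f : ℝ → ℝ} {a b x : ℝ} (hf : ContDiffOn ℝ 1 f (Icc a b))
    (hx : x ∈ Ioo a b) : HasDerivAt f (deriv f x) x :=
  ((hf.differentiableOn one_ne_zero).differentiableAt (Icc_mem_nhds hx.1 hx.2)).hasDerivAt

/-- At the endpoints `deriv` depends on values outside the interval, so it need not be continuous
there. It agrees with the continuous `derivWithin` off this null set. -/
lemma intervalIntegrable_deriv_of_contDiffOn {f : ℝ → ℝ} {a b : ℝ} (hab : a < b)
    (hf : ContDiffOn ℝ 1 f (Icc a b)) : IntervalIntegrable (deriv f) volume a b := by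
  have hc : ContinuousOn (derivWithin f (Icc a b)) (Icc a b) :=
    ((contDiffOn_one_iff_derivWithin (uniqueDiffOn_Icc hab)).1 hf).2
  rw [intervalIntegrable_iff_integrableOn_Ioo_of_le hab.le]
  refine ((hc.integrableOn_Icc (μ := volume)).mono_set Ioo_subset_Icc_self).congr_fun
    (fun x hx => ?_) measurableSet_Ioo
  exact derivWithin_of_mem_nhds (Icc_mem_nhds hx.1 hx.2)

/-- The inverse of the primitive of a continuous positive function. -/
lemma exists_contDiff_inverse_primitive {f : ℝ → ℝ} {a b : ℝ} (hab : a ≤ b)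
    (hf : ContinuousOn f (Icc a b)) (hpos : ∀ s ∈ Icc a b, 0 < f s) :
    ∃ F X : ℝ → ℝ, StrictMono F ∧ ContDiff ℝ 1 X ∧ (∀ y, F (X y) = y) ∧
      ∀ x ∈ Icc a b, F x = ∫ s in a..x, f s := by
  -- Extension by constants keeps a positive lower bound on the whole line, so the primitive is a
  -- bijection of ℝ and its inverse has no endpoints to treat.
  set h : ℝ → ℝ := IccExtend hab ((Icc a b).domRestrict f) with hh
  have hc : Continuous h := (continuousOn_iff_continuous_domRestrict.1 hf).Icc_extend'
  have heq : ∀ x ∈ Icc a b, h x = f x := fun x hx => IccExtend_of_mem hab _ hx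
  obtain ⟨c, hcpos, hcle⟩ : ∃ c : ℝ, 0 < c ∧ ∀ x, c ≤ h x := by
    obtain ⟨z, hz, hmin⟩ := isCompact_Icc.exists_isMinOn (nonempty_Icc.2 hab) hf
    refine ⟨f z, hpos z hz, fun x => ?_⟩
    exact hmin (projIcc a b hab x).2
  have hd : ∀ x, HasDerivAt (fun x => ∫ s in a..x, h s) (h x) x := fun x =>
    (hc.integral_hasStrictDerivAt a x).hasDerivAt
  set F : ℝ → ℝ := fun x => ∫ s in a..x, h s with hF
  have hdiff : Differentiable ℝ F := fun x => (hd x).differentiableAt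
  have hmono : StrictMono F := strictMono_of_deriv_pos fun x => by
    rw [(hd x).deriv]; exact hcpos.trans_le (hcle x)
  have hgrow : ∀ x y, x ≤ y → c * (y - x) ≤ F y - F x := fun x y hxy =>
    mul_sub_le_image_sub_of_le_deriv hdiff (fun x => by rw [(hd x).deriv]; exact hcle x) hxy
  have hsurj : Function.Surjective F := by
    refine hdiff.continuous.surjective ?_ ?_
    · refine tendsto_atTop_mono' atTop (f₁ := fun y => c * (y - a) + F a) ?_ ?_
      · filter_upwards [eventually_ge_atTop a] with y hy
        linarith [hgrow a y hy]
      · exact tendsto_atTop_add_const_right _ _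
          ((tendsto_atTop_add_const_right _ (-a) tendsto_id).const_mul_atTop hcpos)
    · refine tendsto_atBot_mono' atBot (f₁ := fun y => c * (y - a) + F a) ?_ ?_
      · filter_upwards [eventually_le_atBot a] with y hy
        linarith [hgrow y a hy]
      · exact tendsto_atBot_add_const_right _ _
          ((tendsto_atBot_add_const_right _ (-a) tendsto_id).const_mul_atBot hcpos)
  set e := StrictMono.orderIsoOfSurjective F hmono hsurj with he
  have hright : ∀ y, F (e.symm y) = y := fun y => e.apply_symm_apply y
  have hXc : Continuous e.symm := e.symm.continuous
  have hXd : ∀ y, HasDerivAt e.symm (h (e.symm y))⁻¹ y := fun y =>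
    HasDerivAt.of_local_left_inverse hXc.continuousAt (hd _)
      (hcpos.trans_le (hcle _)).ne' (Eventually.of_forall hright)
  refine ⟨F, e.symm, hmono, ?_, hright, fun x hx => ?_⟩
  · rw [contDiff_one_iff_deriv]
    refine ⟨fun y => (hXd y).differentiableAt, ?_⟩
    have : deriv (e.symm : ℝ → ℝ) = fun y => (h (e.symm y))⁻¹ := funext fun y => (hXd y).deriv
    rw [this]
    exact (hc.comp hXc).inv₀ fun y => (hcpos.trans_le (hcle _)).ne'
  · refine intervalIntegral.integral_congr fun s hs => ?_
    rw [uIcc_of_le hx.1] at hs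
    exact heq s ⟨hs.1, hs.2.trans hx.2⟩

/-- An initial value and a lower bound of the derivative locate the solution of `f x = v`. -/
lemma existsUnique_eq_of_le_deriv {f f' : ℝ → ℝ} {I C ℓ v : ℝ} (hC : 0 ≤ C) (hℓ : 0 < ℓ)
    (hI : C * ℓ < I) (hf : ContinuousOn f (Icc 0 ℓ))
    (hd : ∀ x ∈ Ioo 0 ℓ, HasDerivAt f (f' x) x) (hle : ∀ x ∈ Ioo 0 ℓ, I - C * x ≤ f' x)
    (hv₀ : f 0 < v) (hv₁ : v < f 0 + ℓ * (I - ℓ / 2 * C)) :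
    ∃! x : ℝ, x ∈ Ioo 0 ℓ ∧ f x = v := by
  have hmono : StrictMonoOn f (Icc 0 ℓ) := by
    refine strictMonoOn_of_deriv_pos (convex_Icc 0 ℓ) hf fun x hx => ?_
    rw [interior_Icc] at hx
    rw [(hd x hx).deriv]
    nlinarith [hle x hx, hx.2]
  have hend : f 0 + ℓ * (I - ℓ / 2 * C) ≤ f ℓ := by
    -- Comparison with the primitive of the lower bound I − Cx, whose value at ℓ is exactly the
    -- increment ℓ(I − ℓC/2).
    have hm : MonotoneOn (fun x => f x - (I * x - C * x ^ 2 / 2)) (Icc 0 ℓ) := by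
      have hder : ∀ x ∈ Ioo 0 ℓ,
          HasDerivAt (fun x => f x - (I * x - C * x ^ 2 / 2)) (f' x - (I - C * x)) x := by
        intro x hx
        have h1 : HasDerivAt (fun x : ℝ => I * x - C * x ^ 2 / 2) (I - C * x) x := by
          convert! ((hasDerivAt_id x).const_mul I).sub
            (((hasDerivAt_pow 2 x).const_mul C).div_const 2) using 1
          simp; ring
        exact (hd x hx).sub h1
      refine monotoneOn_of_deriv_nonneg (convex_Icc 0 ℓ) (hf.sub (by fun_prop)) ?_ ?_
      · rw [interior_Icc]
        exact fun x hx => (hder x hx).differentiableAt.differentiableWithinAt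
      · rw [interior_Icc]
        intro x hx
        rw [(hder x hx).deriv]
        linarith [hle x hx]
    have := hm (left_mem_Icc.2 hℓ.le) (right_mem_Icc.2 hℓ.le) hℓ.le
    simp only at this
    nlinarith
  obtain ⟨x, hx, hfx⟩ := intermediate_value_Ioo hℓ.le hf ⟨hv₀, hv₁.trans_le hend⟩
  exact ⟨x, ⟨hx, hfx⟩, fun z hz => hmono.injOn (Ioo_subset_Icc_self hz.1) (Ioo_subset_Icc_self hx)
    (hz.2.trans hfx.symm)⟩

/-! Integrals that depend on a parameter. -/

lemma continuousOn_slice {F : ℝ × ℝ → ℝ} {s t : Set ℝ} {x : ℝ} (hF : ContinuousOn F (s ×ˢ t))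
    (hx : x ∈ s) : ContinuousOn (fun y => F (x, y)) t :=
  hF.comp (by fun_prop) fun _ hy => ⟨hx, hy⟩

/-- Dominated convergence. The weight is only integrable because one of its uses has a factor `deriv
d.quotient`, which is uncontrolled at the endpoints. -/
lemma continuousOn_integral_mul {w : ℝ → ℝ} {F : ℝ × ℝ → ℝ} {ℓ M : ℝ} (hM : 0 ≤ M)
    (hw : IntervalIntegrable w volume 0 M) (hF : ContinuousOn F (Icc 0 ℓ ×ˢ Icc 0 M)) :
    ContinuousOn (fun x => ∫ y in (0 : ℝ)..M, w y * F (x, y)) (Icc 0 ℓ) := by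
  obtain ⟨K, hK⟩ := (isCompact_Icc.prod isCompact_Icc).exists_bound_of_continuousOn hF
  have hsub : uIoc 0 M ⊆ Icc 0 M := by rw [uIoc_of_le hM]; exact Ioc_subset_Icc_self
  intro x hx
  refine intervalIntegral.continuousWithinAt_of_dominated_interval (bound := fun y => |w y| * K)
    ?_ ?_ (hw.abs.mul_const K) ?_
  · filter_upwards [self_mem_nhdsWithin] with z hz
    have h1 := (continuousOn_slice hF hz).mono hsub
    exact hw.def'.aestronglyMeasurable.mul (h1.aestronglyMeasurable measurableSet_uIoc)
  · filter_upwards [self_mem_nhdsWithin] with z hz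
    refine Eventually.of_forall fun y hy => ?_
    rw [norm_mul]
    exact mul_le_mul_of_nonneg_left (hK (z, y) ⟨hz, hsub hy⟩) (norm_nonneg _)
  · refine Eventually.of_forall fun y hy => ?_
    have h1 : ContinuousOn (fun z => F (z, y)) (Icc 0 ℓ) :=
      hF.comp (by fun_prop) fun _ hz => ⟨hz, hsub hy⟩
    exact (h1 x hx).const_mul (w y)

lemma ae_uIoc_of_Ioo {p : ℝ → Prop} {M : ℝ} (hM : 0 ≤ M) (h : ∀ y ∈ Ioo 0 M, p y) :
    ∀ᵐ y, y ∈ uIoc 0 M → p y := by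
  have : ∀ᵐ y : ℝ, y ≠ M := by simp [ae_iff]
  filter_upwards [this] with y hy hmem
  rw [uIoc_of_le hM] at hmem
  exact h y ⟨hmem.1, lt_of_le_of_ne hmem.2 hy⟩

lemma aestronglyMeasurable_uIoc_of_Ioo {f : ℝ → ℝ} {M : ℝ} (hM : 0 ≤ M)
    (hf : ContinuousOn f (Ioo 0 M)) :
    AEStronglyMeasurable f (volume.restrict (uIoc 0 M)) := by
  rw [uIoc_of_le hM, ← Measure.restrict_congr_set Ioo_ae_eq_Ioc]
  exact hf.aestronglyMeasurable measurableSet_Ioo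

lemma intervalIntegrable_mul_slice {w : ℝ → ℝ} {F : ℝ × ℝ → ℝ} {ℓ M K x : ℝ} (hM : 0 ≤ M)
    (hw : ContinuousOn w (Icc 0 M)) (hF : ContinuousOn F (Ioo 0 ℓ ×ˢ Ioo 0 M))
    (hK : ∀ z ∈ Ioo 0 ℓ ×ˢ Ioo 0 M, |F z| ≤ K) (hx : x ∈ Ioo 0 ℓ) :
    IntervalIntegrable (fun y => w y * F (x, y)) volume 0 M := by
  have hwi : IntervalIntegrable w volume 0 M :=
    ContinuousOn.intervalIntegrable (by rwa [uIcc_of_le hM])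
  refine (hwi.abs.mul_const K).mono_fun ?_ ?_
  · exact hwi.def'.aestronglyMeasurable.mul
      (aestronglyMeasurable_uIoc_of_Ioo hM (continuousOn_slice hF hx))
  · rw [EventuallyLE, ae_restrict_iff' measurableSet_uIoc]
    refine ae_uIoc_of_Ioo hM fun y hy => ?_
    rw [norm_mul, Real.norm_eq_abs (|w y| * K), abs_mul, abs_abs]
    exact mul_le_mul_of_nonneg_left ((hK (x, y) ⟨hx, hy⟩).trans (le_abs_self K)) (abs_nonneg _)

/-- Differentiation under the integral, dominated by |w|K. The derivative is needed only in the open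
rectangle, since the ends of the y-interval form a null set. -/
lemma hasDerivAt_integral_mul {w : ℝ → ℝ} {F F₁ : ℝ × ℝ → ℝ} {ℓ M K x : ℝ} (hM : 0 ≤ M)
    (hw : ContinuousOn w (Icc 0 M)) (hF : ContinuousOn F (Icc 0 ℓ ×ˢ Icc 0 M))
    (hF₁ : ContinuousOn F₁ (Ioo 0 ℓ ×ˢ Ioo 0 M)) (hK : ∀ z ∈ Ioo 0 ℓ ×ˢ Ioo 0 M, |F₁ z| ≤ K)
    (hd : ∀ z ∈ Ioo 0 ℓ ×ˢ Ioo 0 M, HasDerivAt (fun t => F (t, z.2)) (F₁ z) z.1)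
    (hx : x ∈ Ioo 0 ℓ) :
    HasDerivAt (fun x => ∫ y in (0 : ℝ)..M, w y * F (x, y))
      (∫ y in (0 : ℝ)..M, w y * F₁ (x, y)) x := by
  have hwi : IntervalIntegrable w volume 0 M :=
    ContinuousOn.intervalIntegrable (by rwa [uIcc_of_le hM])
  have hsl : ∀ z ∈ Ioo 0 ℓ, ContinuousOn (fun y => w y * F (z, y)) (Icc 0 M) := fun z hz =>
    hw.mul (continuousOn_slice hF (Ioo_subset_Icc_self hz))
  refine (intervalIntegral.hasDerivAt_integral_of_dominated_loc_of_deriv_le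
    (F' := fun x y => w y * F₁ (x, y)) (bound := fun y => |w y| * K)
    (Ioo_mem_nhds hx.1 hx.2) ?_ ?_ ?_ ?_ (hwi.abs.mul_const K) ?_).2
  · filter_upwards [Ioo_mem_nhds hx.1 hx.2] with z hz
    exact aestronglyMeasurable_uIoc_of_Ioo hM ((hsl z hz).mono Ioo_subset_Icc_self)
  · exact ContinuousOn.intervalIntegrable (by rw [uIcc_of_le hM]; exact hsl x hx)
  · exact (intervalIntegrable_mul_slice hM hw hF₁ hK hx).def'.aestronglyMeasurable
  · refine ae_uIoc_of_Ioo hM fun y hy z hz => ?_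
    rw [norm_mul]
    exact mul_le_mul_of_nonneg_left (hK (z, y) ⟨hz, hy⟩) (norm_nonneg _)
  · exact ae_uIoc_of_Ioo hM fun y hy z hz => (hd (z, y) ⟨hz, hy⟩).const_mul (w y)

lemma abs_integral_mul_sub_le {w : ℝ → ℝ} {F : ℝ × ℝ → ℝ} {ℓ M K K' x x' : ℝ} (hM : 0 ≤ M)
    (hw : ContinuousOn w (Icc 0 M)) (hF : ContinuousOn F (Ioo 0 ℓ ×ˢ Ioo 0 M))
    (hK' : ∀ z ∈ Ioo 0 ℓ ×ˢ Ioo 0 M, |F z| ≤ K') (hx : x ∈ Ioo 0 ℓ) (hx' : x' ∈ Ioo 0 ℓ)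
    (hlip : ∀ y ∈ Ioo 0 M, |F (x, y) - F (x', y)| ≤ K * |x - x'|) :
    |(∫ y in (0 : ℝ)..M, w y * F (x, y)) - ∫ y in (0 : ℝ)..M, w y * F (x', y)|
      ≤ K * (∫ y in (0 : ℝ)..M, |w y|) * |x - x'| := by
  have hwi : IntervalIntegrable w volume 0 M :=
    ContinuousOn.intervalIntegrable (by rwa [uIcc_of_le hM])
  rw [← intervalIntegral.integral_sub (intervalIntegrable_mul_slice hM hw hF hK' hx)
    (intervalIntegrable_mul_slice hM hw hF hK' hx')]
  have h1 := intervalIntegral.norm_integral_le_of_norm_le (μ := volume) hM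
    (f := fun y => w y * F (x, y) - w y * F (x', y)) (g := fun y => |w y| * (K * |x - x'|)) ?_
    (hwi.abs.mul_const _)
  · rw [intervalIntegral.integral_mul_const] at h1
    rw [Real.norm_eq_abs] at h1
    linarith
  · have := ae_uIoc_of_Ioo (p := fun y => ‖w y * F (x, y) - w y * F (x', y)‖
        ≤ |w y| * (K * |x - x'|)) hM fun y hy => by
      rw [← mul_sub, norm_mul]
      exact mul_le_mul_of_nonneg_left (hlip y hy) (norm_nonneg _)
    rwa [uIoc_of_le hM] at this

/-! Partial derivatives and Hölder norms. -/

lemma hasDerivAt_pd₁ {f : ℝ × ℝ → ℝ} {N : Set (ℝ × ℝ)} (hN : IsOpen N) (hf : ContDiffOn ℝ 1 f N)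
    {y : ℝ × ℝ} (hy : y ∈ N) :
    HasDerivAt (fun t => f (t, y.2)) (fderiv ℝ f y (1, 0)) y.1 := by
  have h1 := ((hf.differentiableOn one_ne_zero).differentiableAt (hN.mem_nhds hy)).hasFDerivAt
  exact h1.comp_hasDerivAt (f := fun t => (t, y.2)) y.1
    ((hasDerivAt_id y.1).prodMk (hasDerivAt_const y.1 y.2))

lemma hasDerivAt_pd₂ {f : ℝ × ℝ → ℝ} {N : Set (ℝ × ℝ)} (hN : IsOpen N) (hf : ContDiffOn ℝ 1 f N)
    {y : ℝ × ℝ} (hy : y ∈ N) :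
    HasDerivAt (fun t => f (y.1, t)) (fderiv ℝ f y (0, 1)) y.2 := by
  have h1 := ((hf.differentiableOn one_ne_zero).differentiableAt (hN.mem_nhds hy)).hasFDerivAt
  exact h1.comp_hasDerivAt (f := fun t => (y.1, t)) y.2
    ((hasDerivAt_const y.2 y.1).prodMk (hasDerivAt_id y.2))

lemma contDiffOn_pd₁ {f : ℝ × ℝ → ℝ} {N : Set (ℝ × ℝ)} (hN : IsOpen N) (hf : ContDiffOn ℝ 2 f N) :
    ContDiffOn ℝ 1 (pd₁ f) N := by
  have h1 : ContDiffOn ℝ 1 (fderiv ℝ f) N := hf.fderiv_of_isOpen hN (by norm_num)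
  refine (h1.clm_apply (contDiffOn_const (c := ((1, 0) : ℝ × ℝ)))).congr fun y hy => ?_
  exact (hasDerivAt_pd₁ hN (hf.of_le (by norm_num)) hy).deriv

/-- Each supremum is one nonnegative term of the sums that define the norm. -/
lemma abs_pdMulti_le {k : ℕ} {α c : ℝ} (hc : 0 ≤ c) {N : Set (ℝ × ℝ)} {f : ℝ × ℝ → ℝ}
    (h : holderNorm k α N f ≤ ENNReal.ofReal c) {ν : ℕ × ℕ} (hν : ν.1 + ν.2 ≤ k)
    {y : ℝ × ℝ} (hy : y ∈ N) : |pdMulti ν f y| ≤ c := by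
  have h1 : ENNReal.ofReal |pdMulti ν f y| ≤ supNorm k N f := by
    calc ENNReal.ofReal |pdMulti ν f y| ≤ ⨆ y ∈ N, ENNReal.ofReal |pdMulti ν f y| :=
          le_iSup₂_of_le y hy le_rfl
      _ ≤ ∑ ν ∈ Finset.HasAntidiagonal.antidiagonal (ν.1 + ν.2),
            ⨆ y ∈ N, ENNReal.ofReal |pdMulti ν f y| :=
          Finset.single_le_sum (f := fun ν => ⨆ y ∈ N, ENNReal.ofReal |pdMulti ν f y|)
            (fun _ _ => zero_le) (Finset.HasAntidiagonal.mem_antidiagonal.2 rfl)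
      _ ≤ supNorm k N f :=
          Finset.single_le_sum (f := fun j => ∑ ν ∈ Finset.HasAntidiagonal.antidiagonal j,
            ⨆ y ∈ N, ENNReal.ofReal |pdMulti ν f y|)
            (fun _ _ => zero_le) (Finset.mem_range.2 (by omega))
  exact (ENNReal.ofReal_le_ofReal_iff hc).1 (h1.trans (le_self_add.trans h))

/-! The background shock. -/

/-- The two coefficients `𝔞₁`, `𝔞₃` of a normal shock agree only if `P₊ = (1 + γ) P₋`. -/
lemma pressure_eq_of_coefficients_eq {γ ρm um Pm ρp up Pp : ℝ} (hγ : 1 < γ) (hρm : 0 < ρm)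
    (hum : 0 < um) (hPm : 0 < Pm) (hρp : 0 < ρp) (hup : 0 < up) (hPp : 0 < Pp)
    (hsup : 1 < um ^ 2 / (γ * Pm / ρm)) (hsub : up ^ 2 / (γ * Pp / ρp) < 1)
    (hmass : ρp * up = ρm * um) (hmom : ρp * up ^ 2 + Pp = ρm * um ^ 2 + Pm)
    (hber : up ^ 2 / 2 + γ * Pp / ((γ - 1) * ρp) = um ^ 2 / 2 + γ * Pm / ((γ - 1) * ρm))
    (hcoef : -((um ^ 2 / (γ * Pm / ρm) - 1) / (ρp * up * um)) * (Pp - Pm)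
      = up ^ 2 / (γ * Pp / ρp) / (um ^ 2 / (γ * Pm / ρm))
        * ((um ^ 2 / (γ * Pm / ρm) - 1) / (up ^ 2 / (γ * Pp / ρp) - 1))) :
    Pp = (1 + γ) * Pm := by
  -- A and B are the momentum fluxes ρu², Q and R are ρc² = γP; the squared Mach numbers become A/Q
  -- and B/R.
  obtain ⟨A, hA⟩ : ∃ A, A = ρm * um ^ 2 := ⟨_, rfl⟩
  obtain ⟨B, hB⟩ : ∃ B, B = ρp * up ^ 2 := ⟨_, rfl⟩
  obtain ⟨Q, hQ⟩ : ∃ Q, Q = γ * Pm := ⟨_, rfl⟩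
  obtain ⟨R, hR⟩ : ∃ R, R = γ * Pp := ⟨_, rfl⟩
  have hγ0 : 0 < γ := by linarith
  have hA0 : 0 < A := by rw [hA]; positivity
  have hB0 : 0 < B := by rw [hB]; positivity
  have hQ0 : 0 < Q := by rw [hQ]; positivity
  have hR0 : 0 < R := by rw [hR]; positivity
  have hMm : um ^ 2 / (γ * Pm / ρm) = A / Q := by rw [hA, hQ]; field_simp
  have hMp : up ^ 2 / (γ * Pp / ρp) = B / R := by rw [hB, hR]; field_simp
  have hAj : ρp * up * um = A := by rw [hmass, hA]; ring
  rw [hMm, one_lt_div hQ0] at hsup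
  rw [hMp, div_lt_one hR0] at hsub
  rw [hMm, hMp, hAj] at hcoef
  have hPd : Pp - Pm = A - B := by rw [hA, hB]; linarith
  have hRQ : R = Q + γ * (A - B) := by rw [← hPd, hR, hQ]; ring
  have hAB : A - B ≠ 0 := by
    intro h
    rw [h] at hRQ
    linarith
  have hγ1 : γ - 1 ≠ 0 := by linarith
  -- The Bernoulli relation times 2(γ − 1)j², where j is the common mass flux.
  have hquad : (γ - 1) * (B ^ 2 - A ^ 2) + 2 * (R * B - Q * A) = 0 := by
    field_simp at hber
    have hBj : B = ρm * um * up := by rw [hB, ← hmass]; ring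
    have h3 : ρp * ((γ - 1) * (B ^ 2 - A ^ 2) + 2 * (R * B - Q * A)) = 0 := by
      have e1 : ρp * B ^ 2 = ρm ^ 2 * um ^ 2 * (ρp * up ^ 2) := by rw [hBj]; ring
      have e2 : ρp * A ^ 2 = ρm ^ 2 * um ^ 2 * (ρp * um ^ 2) := by rw [hA]; ring
      have e3 : ρp * B = ρm ^ 2 * um ^ 2 := by rw [hB, ← mul_pow, ← hmass]; ring
      have e4 : ρp * A = ρp * ρm * um ^ 2 := by rw [hA]; ring
      calc ρp * ((γ - 1) * (B ^ 2 - A ^ 2) + 2 * (R * B - Q * A))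
          = (γ - 1) * (ρp * B ^ 2 - ρp * A ^ 2) + 2 * (R * (ρp * B) - Q * (ρp * A)) := by ring
        _ = 0 := by
          rw [e1, e2, e3, e4, hR, hQ]
          linear_combination (ρm * um ^ 2) * hber
    exact (mul_eq_zero.1 h3).resolve_left hρp.ne'
  -- With the momentum relation inserted, A − B factors out; it is nonzero because A = B would give
  -- R = Q, against B < R and Q < A.
  have hlin : (γ + 1) * B = (γ - 1) * A + 2 * Q := by
    have : (A - B) * ((γ + 1) * B - ((γ - 1) * A + 2 * Q)) = 0 := by
      rw [hRQ] at hquad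
      linear_combination hquad
    linarith [(mul_eq_zero.1 this).resolve_left hAB]
  have hRB : R - B = A - Q := by rw [hRQ]; linear_combination -hlin
  have hAQ : A - Q ≠ 0 := by linarith
  -- Equality of the two coefficients, after cancelling the nonzero factors A − Q, A, B − R and
  -- their denominators.
  have hkey : (A - B) * (R - B) = B * Q := by
    rw [hPd, show A / Q - 1 = (A - Q) / Q by field_simp,
      show B / R - 1 = -((R - B) / R) by field_simp; ring] at hcoef
    have hRB0 : R - B ≠ 0 := by linarith
    field_simp at hcoef
    linear_combination -hcoef
  rw [hRB] at hkey
  -- Together, `hkey` and `hlin` determine A/Q; then A − B = Q, so the pressure jump is γP₋.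
  have hAQ' : 2 * A = (γ + 3) * Q := by
    have h1 : (A - B) * (γ + 1) = 2 * (A - Q) := by linear_combination -hlin
    have h2 : A * (2 * A - (γ + 3) * Q) = 0 := by
      linear_combination (γ + 1) * hkey - (A - Q) * h1 + Q * hlin
    linarith [(mul_eq_zero.1 h2).resolve_left hA0.ne']
  have hABQ : A - B = Q := by
    have h1 : (γ + 1) * (A - B - Q) = 0 := by linear_combination -hlin + hAQ'
    linarith [(mul_eq_zero.1 h1).resolve_left (by linarith)]
  linear_combination hPd + hABQ + hQ

/-- Geostrophic balance: for a horizontal flow independent of x₁ the second momentum equation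
reduces to it. -/
lemma Profile.IsFlow.deriv_P {γ β L : ℝ} {p : Profile} (h : p.IsFlow γ β L) (hL : 0 < L) {s : ℝ}
    (hs : s ∈ Ioo (0 : ℝ) 1) : deriv p.P s = -(β * p.ρ s * p.u s) := by
  have h1 := h.euler.momentum₂ (L / 2, s) ⟨⟨by positivity, by simpa using hL⟩, hs⟩
  simp [pd₁, pd₂] at h1
  linarith

/-- The coefficients `𝔞₁` and `𝔞₃` cannot agree identically along a rotating background shock. -/
lemma IsBackgroundShock.exists_coefficients_ne {γ β L : ℝ} {pm pp : Profile}
    (h : IsBackgroundShock γ β L pm pp) (hγ : 1 < γ) (hβ : 0 < β) (hL : 0 < L) :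
    ∃ s ∈ Icc (0 : ℝ) 1,
      -((pm.machSq γ s - 1) / (pp.ρ s * pp.u s * pm.u s)) * (pp.P s - pm.P s)
        ≠ pp.machSq γ s / pm.machSq γ s * ((pm.machSq γ s - 1) / (pp.machSq γ s - 1)) := by
  by_contra! hne
  have hP : ∀ s ∈ Icc (0 : ℝ) 1, pp.P s = (1 + γ) * pm.P s := fun s hs =>
    pressure_eq_of_coefficients_eq hγ (h.flow_minus.pos_ρ s hs) (h.flow_minus.pos_u s hs)
      (h.flow_minus.pos_P s hs) (h.flow_plus.pos_ρ s hs) (h.flow_plus.pos_u s hs)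
      (h.flow_plus.pos_P s hs) (h.supersonic s hs) (h.subsonic s hs) (h.jump_mass s hs)
      (h.jump_momentum s hs) (h.jump_bernoulli s hs) (hne s hs)
  have hs : (1 / 2 : ℝ) ∈ Ioo (0 : ℝ) 1 := by norm_num
  have hs' := Ioo_subset_Icc_self hs
  -- With geostrophic balance and equal mass fluxes this becomes γβρ₋u₋ = 0 at an interior point.
  have hd : deriv pp.P (1 / 2) = (1 + γ) * deriv pm.P (1 / 2) := by
    rw [← deriv_const_mul_field]
    refine Filter.EventuallyEq.deriv_eq ?_
    filter_upwards [Icc_mem_nhds hs.1 hs.2] with s hs using hP s hs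
  rw [h.flow_plus.deriv_P hL hs, h.flow_minus.deriv_P hL hs, mul_assoc β, h.jump_mass _ hs'] at hd
  have := mul_pos (mul_pos (by linarith : 0 < γ) hβ)
    (mul_pos (h.flow_minus.pos_ρ _ hs') (h.flow_minus.pos_u _ hs'))
  linarith

/-! Profiles and coefficients in the Lagrangian coordinate. -/

/-- A positive profile of class `C¹` on `[0,M]`. -/
structure Profile.IsRegular (q : Profile) (M : ℝ) : Prop where
  smooth_ρ : ContDiffOn ℝ 1 q.ρ (Icc 0 M)
  smooth_u : ContDiffOn ℝ 1 q.u (Icc 0 M)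
  smooth_P : ContDiffOn ℝ 1 q.P (Icc 0 M)
  pos_ρ : ∀ s ∈ Icc 0 M, 0 < q.ρ s
  pos_u : ∀ s ∈ Icc 0 M, 0 < q.u s
  pos_P : ∀ s ∈ Icc 0 M, 0 < q.P s

namespace Profile.IsRegular

variable {q : Profile} {M : ℝ}

/-- The exponent integrates −(log u)'. The closed form yields C¹ regularity of b₂ up to the
endpoints. -/
lemma b₂_eq (h : q.IsRegular M) {y : ℝ} (hy : y ∈ Icc 0 M) : Data.b₂ q y = q.u 0 / q.u y := by
  have h0 : (0 : ℝ) ∈ Icc 0 M := ⟨le_rfl, hy.1.trans hy.2⟩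
  have hsub : Icc 0 y ⊆ Icc 0 M := Icc_subset_Icc_right hy.2
  have hlog : ContDiffOn ℝ 1 (fun s => Real.log (q.u s)) (Icc 0 y) :=
    (h.smooth_u.mono hsub).log fun s hs => (h.pos_u s (hsub hs)).ne'
  have h1 : ∫ s in (0 : ℝ)..y, -(deriv q.u s / q.u s) = Real.log (q.u 0) - Real.log (q.u y) := by
    rw [intervalIntegral.integral_neg, ← neg_sub (Real.log (q.u y)),
      ← intervalIntegral.integral_deriv_of_contDiffOn_Icc hlog hy.1]
    congr 1
    refine intervalIntegral.integral_congr_ae (ae_uIoc_of_Ioo hy.1 fun s hs => ?_)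
    exact ((hasDerivAt_of_contDiffOn_Icc (h.smooth_u.mono hsub) hs).log
      (h.pos_u s (hsub (Ioo_subset_Icc_self hs))).ne').deriv.symm
  rw [Data.b₂, h1, Real.exp_sub, Real.exp_log (h.pos_u 0 h0), Real.exp_log (h.pos_u y hy)]

lemma contDiffOn_b₂ (h : q.IsRegular M) : ContDiffOn ℝ 1 (Data.b₂ q) (Icc 0 M) :=
  (contDiffOn_const.div h.smooth_u fun s hs => (h.pos_u s hs).ne').congr fun _ hy => h.b₂_eq hy

lemma contDiffOn_machSq (h : q.IsRegular M) {γ : ℝ} (hγ : γ ≠ 0) :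
    ContDiffOn ℝ 1 (q.machSq γ) (Icc 0 M) := by
  refine (h.smooth_u.pow 2).div ((contDiffOn_const.mul h.smooth_P).div h.smooth_ρ
    fun s hs => (h.pos_ρ s hs).ne') fun s hs => ?_
  exact div_ne_zero (mul_ne_zero hγ (h.pos_P s hs).ne') (h.pos_ρ s hs).ne'

lemma contDiffOn_b₁ (h : q.IsRegular M) (d : Data) (hγ : d.γ ≠ 0) :
    ContDiffOn ℝ 1 (d.b₁ q) (Icc 0 M) :=
  ((contDiffOn_const.sub (h.contDiffOn_machSq hγ)).div (h.smooth_ρ.mul h.smooth_u)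
    fun s hs => (mul_pos (h.pos_ρ s hs) (h.pos_u s hs)).ne').mul h.contDiffOn_b₂

lemma b₁_ne_zero (h : q.IsRegular M) (d : Data) {y : ℝ} (hy : y ∈ Icc 0 M)
    (hM : q.machSq d.γ y ≠ 1) : d.b₁ q y ≠ 0 :=
  mul_ne_zero (div_ne_zero (sub_ne_zero.2 hM.symm)
    (mul_pos (h.pos_ρ y hy) (h.pos_u y hy)).ne') (Real.exp_pos _).ne'

end Profile.IsRegular

namespace Data

variable {d : Data} {α : ℝ}

/-- On [0,m̄] the set-theoretic inverse `d.Xbar` coincides with the globally C¹ inverse of an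
extended primitive, by injectivity. -/
lemma Admissible.lagrangian (hd : d.Admissible α) :
    0 < d.mbar ∧ MapsTo d.Xbar (Icc 0 d.mbar) (Icc 0 1) ∧
      ContDiffOn ℝ 1 d.Xbar (Icc 0 d.mbar) ∧
      ∀ s ∈ Icc (0 : ℝ) 1, ∃ y ∈ Icc 0 d.mbar, d.Xbar y = s := by
  have hb := hd.background.flow_minus
  obtain ⟨F, X, hF, hX, hFX, hFint⟩ := exists_contDiff_inverse_primitive zero_le_one
    (hb.smooth_ρ.continuousOn.mul hb.smooth_u.continuousOn)
    fun s hs => mul_pos (hb.pos_ρ s hs) (hb.pos_u s hs)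
  have hFY : ∀ x ∈ Icc (0 : ℝ) 1, F x = d.Ybar x := hFint
  have hF0 : F 0 = 0 := by rw [hFY 0 (by simp), Ybar, intervalIntegral.integral_same]
  have hF1 : F 1 = d.mbar := hFY 1 (by simp)
  have hXmem : ∀ y ∈ Icc 0 d.mbar, X y ∈ Icc (0 : ℝ) 1 := fun y hy => by
    constructor
    · rw [← hF.le_iff_le, hFX, hF0]; exact hy.1
    · rw [← hF.le_iff_le, hFX, hF1]; exact hy.2
  have heq : ∀ y ∈ Icc 0 d.mbar, d.Xbar y = X y := fun y hy => by
    have hex : ∃ s ∈ Icc (0 : ℝ) 1, d.Ybar s = y :=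
      ⟨X y, hXmem y hy, by rw [← hFY _ (hXmem y hy), hFX]⟩
    have h1 : d.Xbar y ∈ Icc (0 : ℝ) 1 := Function.invFunOn_mem hex
    have h2 : d.Ybar (d.Xbar y) = y := Function.invFunOn_eq hex
    exact hF.injective (by rw [hFX, hFY _ h1, h2])
  refine ⟨?_, fun y hy => by rw [heq y hy]; exact hXmem y hy, hX.contDiffOn.congr heq,
    fun s hs => ?_⟩
  · rw [← hF1, ← hF0]; exact hF zero_lt_one
  · have hmem : F s ∈ Icc 0 d.mbar := by
      rw [← hF1, ← hF0]; exact ⟨hF.monotone hs.1, hF.monotone hs.2⟩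
    exact ⟨F s, hmem, by rw [heq _ hmem]; exact hF.injective (hFX _)⟩

lemma Admissible.isRegular_comp (hd : d.Admissible α) {p : Profile} {γ β L : ℝ}
    (hp : p.IsFlow γ β L) : (p.comp d.Xbar).IsRegular d.mbar := by
  obtain ⟨-, hmaps, hX, -⟩ := hd.lagrangian
  exact
    { smooth_ρ := (hp.smooth_ρ.of_le (by norm_num)).comp hX hmaps
      smooth_u := (hp.smooth_u.of_le (by norm_num)).comp hX hmaps
      smooth_P := (hp.smooth_P.of_le (by norm_num)).comp hX hmaps
      pos_ρ := fun s hs => hp.pos_ρ _ (hmaps hs)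
      pos_u := fun s hs => hp.pos_u _ (hmaps hs)
      pos_P := fun s hs => hp.pos_P _ (hmaps hs) }

lemma Admissible.hm_regular (hd : d.Admissible α) : d.hm.IsRegular d.mbar :=
  hd.isRegular_comp hd.background.flow_minus

lemma Admissible.hp_regular (hd : d.Admissible α) : d.hp.IsRegular d.mbar :=
  hd.isRegular_comp hd.background.flow_plus

lemma Admissible.supersonic (hd : d.Admissible α) {y : ℝ} (hy : y ∈ Icc 0 d.mbar) :
    1 < d.hm.machSq d.γ y :=
  hd.background.supersonic _ (hd.lagrangian.2.1 hy)

lemma Admissible.subsonic (hd : d.Admissible α) {y : ℝ} (hy : y ∈ Icc 0 d.mbar) :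
    d.hp.machSq d.γ y < 1 :=
  hd.background.subsonic _ (hd.lagrangian.2.1 hy)

lemma Admissible.γ_ne_zero (hd : d.Admissible α) : d.γ ≠ 0 := by linarith [hd.one_lt_γ]

lemma Admissible.contDiffOn_a₁ (hd : d.Admissible α) : ContDiffOn ℝ 1 d.a₁ (Icc 0 d.mbar) := by
  have h1 := hd.hm_regular.contDiffOn_machSq hd.γ_ne_zero
  have h2 := hd.hp_regular.contDiffOn_machSq hd.γ_ne_zero
  exact (h2.div h1 fun y hy => by linarith [hd.supersonic hy]).mul
    ((h1.sub contDiffOn_const).div (h2.sub contDiffOn_const)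
      fun y hy => by linarith [hd.subsonic hy])

lemma Admissible.contDiffOn_a₃ (hd : d.Admissible α) : ContDiffOn ℝ 1 d.a₃ (Icc 0 d.mbar) := by
  have hm := hd.hm_regular
  have hp := hd.hp_regular
  have h1 := hm.contDiffOn_machSq hd.γ_ne_zero
  exact ((h1.sub contDiffOn_const).div ((hp.smooth_ρ.mul hp.smooth_u).mul hm.smooth_u)
    fun y hy => (mul_pos (mul_pos (hp.pos_ρ y hy) (hp.pos_u y hy)) (hm.pos_u y hy)).ne').neg.mul
    (hp.smooth_P.sub hm.smooth_P)

lemma Admissible.contDiffOn_weight (hd : d.Admissible α) :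
    ContDiffOn ℝ 1 (fun y => (d.a₃ y - d.a₁ y) * d.b₁ d.hp y) (Icc 0 d.mbar) :=
  (hd.contDiffOn_a₃.sub hd.contDiffOn_a₁).mul (hd.hp_regular.contDiffOn_b₁ d hd.γ_ne_zero)

lemma Admissible.b₁_hm_ne_zero (hd : d.Admissible α) {y : ℝ} (hy : y ∈ Icc 0 d.mbar) :
    d.b₁ d.hm y ≠ 0 :=
  hd.hm_regular.b₁_ne_zero d hy (hd.supersonic hy).ne'

lemma Admissible.contDiffOn_quotient (hd : d.Admissible α) :
    ContDiffOn ℝ 1 (fun y => d.b₁ d.hp y * (d.a₃ y - d.a₁ y) / d.b₁ d.hm y) (Icc 0 d.mbar) :=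
  ((hd.hp_regular.contDiffOn_b₁ d hd.γ_ne_zero).mul (hd.contDiffOn_a₃.sub hd.contDiffOn_a₁)).div
    (hd.hm_regular.contDiffOn_b₁ d hd.γ_ne_zero) fun _ hy => hd.b₁_hm_ne_zero hy

/-- The weight is continuous, and nonzero wherever 𝔞₁ ≠ 𝔞₃, since the downstream state is subsonic
and so b₁₊ ≠ 0. -/
lemma Admissible.integral_abs_weight_pos (hd : d.Admissible α) :
    0 < ∫ y in (0 : ℝ)..d.mbar, |(d.a₃ y - d.a₁ y) * d.b₁ d.hp y| := by
  obtain ⟨hM, -, -, hsurj⟩ := hd.lagrangian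
  obtain ⟨s, hs, hne⟩ := hd.background.exists_coefficients_ne hd.one_lt_γ hd.β_pos hd.L_pos
  obtain ⟨y, hy, rfl⟩ := hsurj s hs
  refine intervalIntegral.integral_pos hM hd.contDiffOn_weight.continuousOn.abs
    (fun _ _ => abs_nonneg _) ⟨y, hy, abs_pos.2 (mul_ne_zero (sub_ne_zero.2 hne) ?_)⟩
  exact hd.hp_regular.b₁_ne_zero d hy (hd.subsonic hy).ne

/-! The wall perturbation. -/

lemma Admissible.g_hasDerivWithinAt (hd : d.Admissible α) {x : ℝ} (hx : x ∈ Icc 0 d.L) :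
    HasDerivWithinAt d.g (derivWithin d.g (Icc 0 d.L) x) (Icc 0 d.L) x :=
  (hd.g_holder.1.differentiableOn (by norm_num) x hx).hasDerivWithinAt

lemma Admissible.continuousOn_derivWithin_g (hd : d.Admissible α) :
    ContinuousOn (derivWithin d.g (Icc 0 d.L)) (Icc 0 d.L) :=
  hd.g_holder.1.continuousOn_derivWithin (uniqueDiffOn_Icc hd.L_pos) (by norm_num)

lemma Admissible.g_zero (hd : d.Admissible α) : d.g 0 = 0 := by
  simpa using hd.g_flat 0 (by norm_num)

lemma Admissible.derivWithin_g_zero (hd : d.Admissible α) :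
    derivWithin d.g (Icc 0 d.L) 0 = 0 := by
  simpa [iteratedDerivWithin_one] using hd.g_flat 1 (by norm_num)

/-- The supremum of `|g''|` over `[0,L]`. -/
def supSecondDeriv (d : Data) : ℝ :=
  sSup ((fun y => |iteratedDerivWithin 2 d.g (Icc 0 d.L) y|) '' Icc 0 d.L)

lemma supSecondDeriv_nonneg : 0 ≤ d.supSecondDeriv :=
  Real.sSup_nonneg (by rintro _ ⟨y, -, rfl⟩; exact abs_nonneg _)

lemma Admissible.abs_derivWithin_g_sub_le (hd : d.Admissible α) {x x' : ℝ} (hx : x ∈ Icc 0 d.L)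
    (hx' : x' ∈ Icc 0 d.L) :
    |derivWithin d.g (Icc 0 d.L) x - derivWithin d.g (Icc 0 d.L) x'|
      ≤ d.supSecondDeriv * |x - x'| := by
  have hu := uniqueDiffOn_Icc hd.L_pos
  have hcont : ContinuousOn (iteratedDerivWithin 2 d.g (Icc 0 d.L)) (Icc 0 d.L) :=
    hd.g_holder.1.continuousOn_iteratedDerivWithin (by norm_num) hu
  have hdiff : DifferentiableOn ℝ (derivWithin d.g (Icc 0 d.L)) (Icc 0 d.L) := by
    have := hd.g_holder.1.differentiableOn_iteratedDerivWithin (m := 1) (by norm_num) hu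
    rwa [iteratedDerivWithin_one] at this
  have hder : ∀ z ∈ Icc 0 d.L, HasDerivWithinAt (derivWithin d.g (Icc 0 d.L))
      (iteratedDerivWithin 2 d.g (Icc 0 d.L) z) (Icc 0 d.L) z := fun z hz => by
    have := (hdiff z hz).hasDerivWithinAt
    rwa [← iteratedDerivWithin_one, ← iteratedDerivWithin_succ, iteratedDerivWithin_one] at this
  have hbdd := (isCompact_Icc.image_of_continuousOn hcont.abs).bddAbove
  exact (convex_Icc 0 d.L).norm_image_sub_le_of_norm_hasDerivWithin_le hder
    (fun z hz => le_csSup hbdd (mem_image_of_mem _ hz)) hx' hx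

end Data

/-! ### The function `J₁`: its derivative, the integration by parts, and the limit at the entrance.
-/

namespace Data

variable {d : Data} {α Cm : ℝ} {V : Fin 4 → ℝ × ℝ → ℝ}

/-- The weight of `u̇₁` in `J₁`. -/
def weight (d : Data) (y : ℝ) : ℝ := (d.a₃ y - d.a₁ y) * d.b₁ d.hp y

/-- The quotient of the weight of `u̇₁` in `J₁` by the coefficient `b₁₋`. -/
def quotient (d : Data) (y : ℝ) : ℝ := d.b₁ d.hp y * (d.a₃ y - d.a₁ y) / d.b₁ d.hm y

lemma isOpen_rect : IsOpen d.rect := isOpen_Ioo.prod isOpen_Ioo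

lemma Admissible.C_pos (hd : d.Admissible α) (hCm : 0 < Cm) : 0 < d.C Cm := by
  obtain ⟨hM, -⟩ := hd.lagrangian
  refine add_pos_of_pos_of_nonneg (mul_pos hCm hd.integral_abs_weight_pos)
    (mul_nonneg (mul_pos (Real.exp_pos _) ?_).le d.supSecondDeriv_nonneg)
  exact hd.hp_regular.pos_u _ (right_mem_Icc.2 hM.le)

lemma J₁_zero (hd : d.Admissible α) (hV : d.IsLinSupersonic α V) :
    d.J₁ V 0 = (∫ y in (0 : ℝ)..d.mbar, (d.a₃ y - d.a₁ y) * (d.b₁ d.hp y * d.Ven 0 y))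
      + b₂ d.hp d.mbar * d.hp.u d.mbar * d.g d.L := by
  obtain ⟨hM, -⟩ := hd.lagrangian
  have h1 : ∫ y in (0 : ℝ)..d.mbar, (d.a₃ y - d.a₁ y) * d.b₁ d.hp y * V 0 (0, y)
      = d.σ * ∫ y in (0 : ℝ)..d.mbar, (d.a₃ y - d.a₁ y) * (d.b₁ d.hp y * d.Ven 0 y) := by
    rw [← intervalIntegral.integral_const_mul]
    refine intervalIntegral.integral_congr fun y hy => ?_
    rw [uIcc_of_le hM.le] at hy
    simp only [hV.entrance 0 y hy]
    ring
  rw [J₁, h1, hd.g_zero, sub_zero, ← mul_assoc, one_div_mul_cancel hd.σ_pos.ne', one_mul]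

/-- The derivative of `J₁`. -/
def J₁Deriv (d : Data) (V : Fin 4 → ℝ × ℝ → ℝ) (ψ : ℝ) : ℝ :=
  1 / d.σ * (∫ y in (0 : ℝ)..d.mbar, d.weight y * pd₁ (V 0) (ψ, y))
    - b₂ d.hp d.mbar * d.hp.u d.mbar * derivWithin d.g (Icc 0 d.L) ψ

/-- The derivative of `J₁` after an integration by parts. -/
def J₁DerivByParts (d : Data) (V : Fin 4 → ℝ × ℝ → ℝ) (ψ : ℝ) : ℝ :=
  1 / d.σ * ((∫ y in (0 : ℝ)..d.mbar, deriv d.quotient y * b₂ d.hm y * V 1 (ψ, y))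
      - d.quotient d.mbar * (b₂ d.hm d.mbar * V 1 (ψ, d.mbar)))
    - b₂ d.hp d.mbar * d.hp.u d.mbar * derivWithin d.g (Icc 0 d.L) ψ

lemma continuousOn_J₁ (hd : d.Admissible α) (hV : d.IsLinSupersonic α V) :
    ContinuousOn (d.J₁ V) (Icc 0 d.L) := by
  obtain ⟨hM, -⟩ := hd.lagrangian
  have hw : IntervalIntegrable d.weight volume 0 d.mbar :=
    ContinuousOn.intervalIntegrable
      (by rw [uIcc_of_le hM.le]; exact hd.contDiffOn_weight.continuousOn)
  exact (continuousOn_const.mul (continuousOn_integral_mul hM.le hw (hV.cont 0))).add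
    (continuousOn_const.mul (continuousOn_const.sub hd.g_holder.1.continuousOn))

lemma IsLinSupersonic.holderNorm_le
    (hVCm : ∑ i, holderNorm 2 α d.rect (V i) ≤ ENNReal.ofReal (Cm * d.σ)) (i : Fin 4) :
    holderNorm 2 α d.rect (V i) ≤ ENNReal.ofReal (Cm * d.σ) :=
  (Finset.single_le_sum (f := fun i => holderNorm 2 α d.rect (V i)) (fun _ _ => zero_le)
    (Finset.mem_univ i)).trans hVCm

lemma abs_pd₁_le (hd : d.Admissible α) (hCm : 0 < Cm)
    (hVCm : ∑ i, holderNorm 2 α d.rect (V i) ≤ ENNReal.ofReal (Cm * d.σ)) :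
    ∀ z ∈ Ioo 0 d.L ×ˢ Ioo 0 d.mbar, |pd₁ (V 0) z| ≤ Cm * d.σ := fun _ hz =>
  abs_pdMulti_le (mul_pos hCm hd.σ_pos).le (IsLinSupersonic.holderNorm_le hVCm 0)
    (ν := (1, 0)) (by norm_num) hz

lemma IsLinSupersonic.continuousOn_pd₁ (hV : d.IsLinSupersonic α V) :
    ContinuousOn (pd₁ (V 0)) (Ioo 0 d.L ×ˢ Ioo 0 d.mbar) :=
  (contDiffOn_pd₁ isOpen_rect (hV.smooth 0)).continuousOn

lemma hasDerivAt_J₁ (hd : d.Admissible α) (hV : d.IsLinSupersonic α V) (hCm : 0 < Cm)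
    (hVCm : ∑ i, holderNorm 2 α d.rect (V i) ≤ ENNReal.ofReal (Cm * d.σ)) {ψ : ℝ}
    (hψ : ψ ∈ Ioo 0 d.L) : HasDerivAt (d.J₁ V) (d.J₁Deriv V ψ) ψ := by
  obtain ⟨hM, -⟩ := hd.lagrangian
  have hint := hasDerivAt_integral_mul hM.le hd.contDiffOn_weight.continuousOn (hV.cont 0)
    hV.continuousOn_pd₁ (abs_pd₁_le hd hCm hVCm)
    (fun z hz => (hasDerivAt_pd₁ isOpen_rect
      ((hV.smooth 0).of_le (by norm_num)) hz).differentiableAt.hasDerivAt) hψ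
  have hg : HasDerivAt d.g (derivWithin d.g (Icc 0 d.L) ψ) ψ :=
    (hd.g_hasDerivWithinAt (Ioo_subset_Icc_self hψ)).hasDerivAt (Icc_mem_nhds hψ.1 hψ.2)
  convert! (hint.const_mul (1 / d.σ)).add
    ((hg.const_sub (d.g d.L)).const_mul (b₂ d.hp d.mbar * d.hp.u d.mbar)) using 1
  rw [J₁Deriv, mul_neg, ← sub_eq_add_neg]
  rfl

/-- The mean value inequality for ∂₁u̇₁ in y₁ has constant 𝒞₋σ, and the prefactor 1/σ cancels σ. No
second derivative of J₁ is needed. -/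
lemma abs_J₁Deriv_sub_le (hd : d.Admissible α) (hV : d.IsLinSupersonic α V) (hCm : 0 < Cm)
    (hVCm : ∑ i, holderNorm 2 α d.rect (V i) ≤ ENNReal.ofReal (Cm * d.σ)) {ψ φ : ℝ}
    (hψ : ψ ∈ Ioo 0 d.L) (hφ : φ ∈ Ioo 0 d.L) :
    |d.J₁Deriv V ψ - d.J₁Deriv V φ| ≤ d.C Cm * |ψ - φ| := by
  obtain ⟨hM, -⟩ := hd.lagrangian
  have hσ := hd.σ_pos
  have hlip : ∀ y ∈ Ioo 0 d.mbar,
      |pd₁ (V 0) (ψ, y) - pd₁ (V 0) (φ, y)| ≤ Cm * d.σ * |ψ - φ| := fun y hy =>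
    (convex_Ioo 0 d.L).norm_image_sub_le_of_norm_hasDerivWithin_le
      (f := fun t => pd₁ (V 0) (t, y)) (f' := fun t => pd₁ (pd₁ (V 0)) (t, y))
      (fun t ht => (hasDerivAt_pd₁ isOpen_rect (contDiffOn_pd₁ isOpen_rect (hV.smooth 0))
        (y := (t, y)) ⟨ht, hy⟩).differentiableAt.hasDerivAt.hasDerivWithinAt)
      (fun t ht => abs_pdMulti_le (mul_pos hCm hσ).le (IsLinSupersonic.holderNorm_le hVCm 0)
        (ν := (2, 0)) (by norm_num) (y := (t, y)) ⟨ht, hy⟩) hφ hψ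
  have h1 := abs_integral_mul_sub_le hM.le hd.contDiffOn_weight.continuousOn hV.continuousOn_pd₁
    (abs_pd₁_le hd hCm hVCm) hψ hφ hlip
  have h2 := hd.abs_derivWithin_g_sub_le (Ioo_subset_Icc_self hψ) (Ioo_subset_Icc_self hφ)
  have hB : 0 < b₂ d.hp d.mbar * d.hp.u d.mbar :=
    mul_pos (Real.exp_pos _) (hd.hp_regular.pos_u _ (right_mem_Icc.2 hM.le))
  rw [J₁Deriv, J₁Deriv, sub_sub_sub_comm, ← mul_sub, ← mul_sub]
  refine (abs_sub _ _).trans ?_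
  rw [abs_mul, abs_mul, abs_of_pos hB, abs_of_pos (one_div_pos.2 hσ)]
  calc _ ≤ 1 / d.σ * (Cm * d.σ * (∫ y in (0 : ℝ)..d.mbar, |d.weight y|) * |ψ - φ|)
        + b₂ d.hp d.mbar * d.hp.u d.mbar * (d.supSecondDeriv * |ψ - φ|) :=
        add_le_add (mul_le_mul_of_nonneg_left h1 (one_div_pos.2 hσ).le)
          (mul_le_mul_of_nonneg_left h2 hB.le)
    _ = d.C Cm * |ψ - φ| := by
        simp only [C, weight, supSecondDeriv]
        field_simp

lemma J₁Deriv_eq_byParts (hd : d.Admissible α) (hV : d.IsLinSupersonic α V) (hCm : 0 < Cm)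
    (hVCm : ∑ i, holderNorm 2 α d.rect (V i) ≤ ENNReal.ofReal (Cm * d.σ)) {ψ : ℝ}
    (hψ : ψ ∈ Ioo 0 d.L) : d.J₁Deriv V ψ = d.J₁DerivByParts V ψ := by
  obtain ⟨hM, -⟩ := hd.lagrangian
  have hψ' := Ioo_subset_Icc_self hψ
  have hb := hd.hm_regular.contDiffOn_b₂
  have hK : ContDiffOn ℝ 1 d.quotient (Icc 0 d.mbar) := hd.contDiffOn_quotient
  have hV1 : ContinuousOn (fun y => b₂ d.hm y * V 1 (ψ, y)) (Icc 0 d.mbar) :=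
    hb.continuousOn.mul (continuousOn_slice (hV.cont 1) hψ')
  have hder : ∀ y ∈ Ioo 0 d.mbar,
      HasDerivAt (fun y => d.quotient y * (b₂ d.hm y * V 1 (ψ, y)))
        (deriv d.quotient y * (b₂ d.hm y * V 1 (ψ, y)) - d.weight y * pd₁ (V 0) (ψ, y)) y := by
    intro y hy
    have hy' := Ioo_subset_Icc_self hy
    have hmem : (ψ, y) ∈ d.rect := ⟨hψ, hy⟩
    have h1 : DifferentiableAt ℝ (fun t => b₂ d.hm t * V 1 (ψ, t)) y :=
      (hasDerivAt_of_contDiffOn_Icc hb hy).differentiableAt.mul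
        (hasDerivAt_pd₂ isOpen_rect ((hV.smooth 1).of_le (by norm_num)) hmem).differentiableAt
    have h2 : deriv (fun t => b₂ d.hm t * V 1 (ψ, t)) y
        = -(d.b₁ d.hm y * pd₁ (V 0) (ψ, y)) := by
      have h3 := hV.eq_div (ψ, y) hmem
      simp only [pd₁, pd₂, deriv_const_mul_field] at h3 ⊢
      linarith
    convert! (hasDerivAt_of_contDiffOn_Icc hK hy).mul h1.hasDerivAt using 1
    -- The quotient is chosen so that the factor b₁₋ from the divergence equation restores the
    -- weight of J₁.
    have h4 : d.quotient y * d.b₁ d.hm y = d.weight y := by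
      rw [quotient, weight, div_mul_cancel₀ _ (hd.b₁_hm_ne_zero hy'), mul_comm]
    rw [h2, ← h4]
    ring
  have hi₁ : IntervalIntegrable (fun y => deriv d.quotient y * (b₂ d.hm y * V 1 (ψ, y)))
      volume 0 d.mbar :=
    (intervalIntegrable_deriv_of_contDiffOn hM hK).mul_continuousOn
      (by rwa [uIcc_of_le hM.le])
  have hi₂ : IntervalIntegrable (fun y => d.weight y * pd₁ (V 0) (ψ, y)) volume 0 d.mbar :=
    intervalIntegrable_mul_slice hM.le hd.contDiffOn_weight.continuousOn hV.continuousOn_pd₁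
      (abs_pd₁_le hd hCm hVCm) hψ
  have hftc := intervalIntegral.integral_eq_sub_of_hasDerivAt_of_le hM.le
    (hK.continuousOn.mul hV1) hder (hi₁.sub hi₂)
  -- The boundary term at y₂ = 0 vanishes by the lower wall condition; the one at m̄ stays.
  rw [intervalIntegral.integral_sub hi₁ hi₂, Pi.mul_apply, Pi.mul_apply,
    hV.lower_wall ψ hψ', mul_zero, mul_zero, sub_zero] at hftc
  simp only [J₁Deriv, J₁DerivByParts, mul_assoc (deriv d.quotient _)]
  rw [← hftc, sub_sub_cancel]

lemma continuousOn_J₁DerivByParts (hd : d.Admissible α) (hV : d.IsLinSupersonic α V) :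
    ContinuousOn (d.J₁DerivByParts V) (Icc 0 d.L) := by
  obtain ⟨hM, -⟩ := hd.lagrangian
  have hb := hd.hm_regular.contDiffOn_b₂.continuousOn
  have hw : IntervalIntegrable (fun y => deriv d.quotient y * b₂ d.hm y) volume 0 d.mbar :=
    (intervalIntegrable_deriv_of_contDiffOn hM hd.contDiffOn_quotient).mul_continuousOn
      (by rwa [uIcc_of_le hM.le])
  have hwall : ContinuousOn (fun ψ => V 1 (ψ, d.mbar)) (Icc 0 d.L) :=
    (hV.cont 1).comp (by fun_prop) fun _ hψ => ⟨hψ, right_mem_Icc.2 hM.le⟩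
  exact (continuousOn_const.mul ((continuousOn_integral_mul hM.le hw (hV.cont 1)).sub
    (continuousOn_const.mul (continuousOn_const.mul hwall)))).sub
    (continuousOn_const.mul hd.continuousOn_derivWithin_g)

/-- Both wall terms contain g'(0) = 0, and the entrance condition supplies σũ₂, whose σ cancels the
prefactor. -/
lemma J₁DerivByParts_zero (hd : d.Admissible α) (hV : d.IsLinSupersonic α V) :
    d.J₁DerivByParts V 0 = d.I := by
  obtain ⟨hM, -⟩ := hd.lagrangian
  have h1 : ∫ y in (0 : ℝ)..d.mbar, deriv d.quotient y * b₂ d.hm y * V 1 (0, y)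
      = d.σ * d.I := by
    rw [I, ← intervalIntegral.integral_const_mul]
    refine intervalIntegral.integral_congr fun y hy => ?_
    rw [uIcc_of_le hM.le] at hy
    simp only [hV.entrance 1 y hy]
    change deriv d.quotient y * _ * _ = d.σ * (deriv d.quotient y * _)
    ring
  rw [J₁DerivByParts, h1, hV.upper_wall 0 (left_mem_Icc.2 hd.L_pos.le), hd.derivWithin_g_zero]
  have := hd.σ_pos.ne'
  field_simp
  ring

/-- The point φ in the Lipschitz estimate is sent to 0 from the right. A limit is needed because
∂₁u̇₁ is controlled only in the open rectangle; the form by parts identifies this limit. -/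
lemma abs_J₁Deriv_sub_I_le (hd : d.Admissible α) (hV : d.IsLinSupersonic α V) (hCm : 0 < Cm)
    (hVCm : ∑ i, holderNorm 2 α d.rect (V i) ≤ ENNReal.ofReal (Cm * d.σ)) {ψ : ℝ}
    (hψ : ψ ∈ Ioo 0 d.L) : |d.J₁Deriv V ψ - d.I| ≤ d.C Cm * ψ := by
  have hlim : Tendsto (d.J₁Deriv V) (𝓝[>] 0) (𝓝 d.I) := by
    have h1 := continuousOn_J₁DerivByParts hd hV 0 (left_mem_Icc.2 hd.L_pos.le)
    rw [ContinuousWithinAt, J₁DerivByParts_zero hd hV] at h1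
    have h2 : Tendsto (d.J₁DerivByParts V) (𝓝[>] 0) (𝓝 d.I) := by
      rw [← nhdsWithin_Ioo_eq_nhdsGT hd.L_pos]
      exact h1.mono_left (nhdsWithin_mono _ Ioo_subset_Icc_self)
    refine h2.congr' ?_
    filter_upwards [Ioo_mem_nhdsGT hd.L_pos] with φ hφ
    exact (J₁Deriv_eq_byParts hd hV hCm hVCm hφ).symm
  have hid : Tendsto (fun φ : ℝ => d.C Cm * |ψ - φ|) (𝓝[>] 0) (𝓝 (d.C Cm * |ψ - 0|)) :=
    ((continuous_const.mul (continuous_const.sub continuous_id).abs).tendsto 0).mono_left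
      nhdsWithin_le_nhds
  rw [sub_zero, abs_of_pos hψ.1] at hid
  refine le_of_tendsto_of_tendsto (hlim.const_sub _).abs hid ?_
  filter_upwards [Ioo_mem_nhdsGT hd.L_pos] with φ hφ
  exact abs_J₁Deriv_sub_le hd hV hCm hVCm hψ hφ

end Data

end RotShock

end

theorem lemma4p4 (d : RotShock.Data) (α : ℝ) (hα : α ∈ Set.Ioo (0 : ℝ) 1)
    (hd : d.Admissible α)
    (V : Fin 4 → ℝ × ℝ → ℝ) (hV : d.IsLinSupersonic α V)
    (Cm : ℝ) (hCm : 0 < Cm)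
    (hVCm : ∑ i, RotShock.holderNorm 2 α d.rect (V i) ≤ ENNReal.ofReal (Cm * d.σ)) :
    0 < d.C Cm ∧
    d.J₁ V 0 = (∫ y in (0 : ℝ)..d.mbar, (d.a₃ y - d.a₁ y) * (d.b₁ d.hp y * d.Ven 0 y))
      + RotShock.Data.b₂ d.hp d.mbar * d.hp.u d.mbar * d.g d.L ∧
    (0 < d.I → ∀ Lp : ℝ, 0 < Lp → Lp < min (1 / d.C Cm * d.I) d.L →
      0 < Lp * (d.I - Lp / 2 * d.C Cm) ∧
      (d.J₁ V 0 < d.J₂ → d.J₂ < d.J₁ V 0 + Lp * (d.I - Lp / 2 * d.C Cm) →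
        ∃! ψ : ℝ, ψ ∈ Set.Ioo 0 Lp ∧ d.J₁ V ψ = d.J₂)) ∧
    (d.I < 0 → ∀ Lm : ℝ, 0 < Lm → Lm < min (-(1 / d.C Cm * d.I)) d.L →
      Lm * (d.I + Lm / 2 * d.C Cm) < 0 ∧
      (d.J₁ V 0 + Lm * (d.I + Lm / 2 * d.C Cm) < d.J₂ → d.J₂ < d.J₁ V 0 →
        ∃! ψ : ℝ, ψ ∈ Set.Ioo 0 Lm ∧ d.J₁ V ψ = d.J₂)) := by
  open RotShock RotShock.Data in
  have hC : 0 < d.C Cm := hd.C_pos hCm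
  have hcont := continuousOn_J₁ hd hV
  have hder : ∀ ψ ∈ Set.Ioo 0 d.L, HasDerivAt (d.J₁ V) (d.J₁Deriv V ψ) ψ := fun _ hψ =>
    hasDerivAt_J₁ hd hV hCm hVCm hψ
  have hbound : ∀ ψ ∈ Set.Ioo 0 d.L, |d.J₁Deriv V ψ - d.I| ≤ d.C Cm * ψ := fun _ hψ =>
    abs_J₁Deriv_sub_I_le hd hV hCm hVCm hψ
  refine ⟨hC, J₁_zero hd hV, fun hI ℓ hℓ hlt => ?_, fun hI ℓ hℓ hlt => ?_⟩
  · rw [lt_min_iff, one_div_mul_eq_div, lt_div_iff₀ hC] at hlt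
    have hsub : Set.Ioo 0 ℓ ⊆ Set.Ioo 0 d.L := Set.Ioo_subset_Ioo_right hlt.2.le
    refine ⟨mul_pos hℓ (by nlinarith), fun h₀ h₁ => ?_⟩
    exact existsUnique_eq_of_le_deriv hC.le hℓ (by linarith)
      (hcont.mono (Set.Icc_subset_Icc_right hlt.2.le)) (fun ψ hψ => hder ψ (hsub hψ))
      (fun ψ hψ => by linarith [(abs_le.1 (hbound ψ (hsub hψ))).1]) h₀ h₁
  · rw [lt_min_iff, one_div_mul_eq_div, ← neg_div, lt_div_iff₀ hC] at hlt
    have hsub : Set.Ioo 0 ℓ ⊆ Set.Ioo 0 d.L := Set.Ioo_subset_Ioo_right hlt.2.le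
    refine ⟨mul_neg_of_pos_of_neg hℓ (by nlinarith), fun h₀ h₁ => ?_⟩
    -- A sign change of J₁, I and J₂ reduces this case to the increasing one.
    have h := existsUnique_eq_of_le_deriv (f := fun ψ => -d.J₁ V ψ) (f' := fun ψ => -d.J₁Deriv V ψ)
      (I := -d.I) (v := -d.J₂) hC.le hℓ (by linarith)
      (hcont.mono (Set.Icc_subset_Icc_right hlt.2.le)).neg (fun ψ hψ => (hder ψ (hsub hψ)).neg)
      (fun ψ hψ => by linarith [(abs_le.1 (hbound ψ (hsub hψ))).2]) (by linarith) (by linarith)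
    simpa only [neg_inj] using h
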